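/- Let $\Bbbk$ be an algebraically closed field and let $R=\bigoplus_{\gamma\in\mathbb{R}_{\ge 0}}R_\gamma$ be an $\mathbb{R}_{\ge0}$-graded integral domain, finitely generated as a $\Bbbk$-algebra, with $R_0=\Bbbk$ and Krull dimension $n$. Let $M=\bigoplus_{\lambda\in\mathbb{R}}M_\lambda$ be a finitely generated $\mathbb{R}$-graded $R$-module. For $x\in\mathbb{R}$ put $M_{\le x}=\bigoplus_{\lambda\le x}M_\lambda$, and $R_{\le x}=\bigoplus_{\gamma\le x}R_\gamma$. Then $R_{\le x}$ and $M_{\le x}$ are finite-dimensional over $\Bbbk$ for every $x$, and there are real constants $a_n(R)$, $a_n(M)$, $a_{n-1}(M)$ such that, as $x\to\infty$, \[ \dim_\Bbbk R_{\le x}=\frac{a_n(R)}{n!}x^n+O(x^{n-1}),\qquad \dim_\Bbbk M_{\le x}=\frac{a_n(M)}{n!}x^n+O(x^{n-1}), \] and, if $n\ge 1$, \[ \lim_{T\to\infty}\frac{1}{T^n}\int_1^T\left(\dim_\Bbbk M_{\le x}-\frac{a_n(M)}{n!}x^n-\frac{a_{n-1}(M)}{(n-1)!}x^{n-1}\right)dx=0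 . \] Moreover $a_n(M)=\operatorname{rank}(M)\,a_n(R)$, where $\operatorname{rank}(M)$ is the rank of $M$ over the domain $R$, i.e. the dimension of $M\otimes_R\operatorname{Frac}(R)$ over $\operatorname{Frac}(R)$. -/

import Mathlib

open Filter Topology Asymptotics
open scoped Nat

/-- `M_{≤ x} = ⨁_{l ≤ x} M_l`, as a `k`-subspace of a module `M` graded by the subspaces `ℳ l`. -/
def gradedLE {k M : Type*} [Field k] [AddCommGroup M] [Module k M]
    (ℳ : ℝ → Submodule k M) (x : ℝ) : Submodule k M :=
  ⨆ l : ℝ, ⨆ _ : l ≤ x, ℳ l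

/-- The counting function `x ↦ dim_k M_{≤ x}`. -/
noncomputable def dimLE {k M : Type*} [Field k] [AddCommGroup M] [Module k M]
    (ℳ : ℝ → Submodule k M) (x : ℝ) : ℝ :=
  (Module.finrank k (gradedLE ℳ x) : ℝ)

/-- `f x = (a / n!) x ^ n + O (x ^ (n - 1))` as `x → ∞`; the exponent `n - 1` is an integer. -/
def HasLeadingTerm (f : ℝ → ℝ) (n : ℕ) (a : ℝ) : Prop :=
  (fun x : ℝ => f x - a / (n ! : ℝ) * x ^ n) =O[atTop] (fun x : ℝ => x ^ ((n : ℤ) - 1))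

/-- `f x - (a / n!) x ^ n - (b / (n - 1)!) x ^ (n - 1)` (used only for `1 ≤ n`). -/
noncomputable def twoTermRemainder (f : ℝ → ℝ) (n : ℕ) (a b : ℝ) (x : ℝ) : ℝ :=
  f x - a / (n ! : ℝ) * x ^ n - b / ((n - 1)! : ℝ) * x ^ (n - 1)

/-- The remainder is integrable on every `[1, T]`, and
`T ^ (-n) * ∫_1^T (remainder) → 0` as `T → ∞`. -/
def HasCesaroSecondTerm (f : ℝ → ℝ) (n : ℕ) (a b : ℝ) : Prop :=
  (∀ T : ℝ, 1 ≤ T →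
    IntervalIntegrable (twoTermRemainder f n a b) MeasureTheory.volume 1 T) ∧
  Tendsto (fun T : ℝ => 1 / T ^ n * ∫ x in (1 : ℝ)..T, twoTermRemainder f n a b x)
    atTop (𝓝 0)

/-!
A finitely generated graded module over the Noetherian ring `R` is filtered by homogeneous
submodules with successive quotients `R / q`, up to a shift of degrees, where `q` is a homogeneous
prime. If `f ∉ p` is homogeneous of degree `d > 0` and `p` is a homogeneous prime, multiplication by
`f` on `R / p` gives `h (x) - h (x - d) = h' (x)` for the dimension functions `h` of
`(R / p)_{≤ x}` and `h'` of `(R / (p + f))_{≤ x}`. Filtering `R / (p + f)` involves only primes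
larger than `p`, and summing the difference equation raises the order of growth by one and divides
the leading coefficient by `d`, which is the induction step on `dim R / p`.

As the degrees and the shifts are arbitrary reals, the `O (x ^ (n - 1))` term of `h` may oscillate.
Its primitive does have a second term, and this is stable under shifts and under summation of the
difference equation. Only the quotients `R / 0` contribute to the leading coefficient of a module,
and there are `rank M` of them.
-/

theorem isBigO_pow_atTop_of_le {p q : ℕ} (h : p ≤ q) :
    (fun x : ℝ => x ^ p) =O[atTop] fun x : ℝ => x ^ q :=
  IsBigO.pow_of_le_right (by
    filter_upwards [eventually_ge_atTop 1] with x hx using by simpa using hx) h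

section Increments

variable {d : ℝ}

theorem forall_of_forall_sub {X : ℝ} (hd : 0 < d) {P : ℝ → Prop} (base : ∀ x < X, P x)
    (step : ∀ x, X ≤ x → P (x - d) → P x) (x : ℝ) : P x := by
  obtain ⟨N, hN⟩ := exists_nat_gt ((x - X) / d)
  replace hN : x < X + N * d := by
    rw [div_lt_iff₀ hd] at hN
    linarith
  induction N generalizing x with
  | zero => exact base x (by simpa using hN)
  | succ N ih =>
    push_cast at hN
    rcases lt_or_ge x X with hx | hx
    · exact base x hx
    · exact step x hx (ih (x - d) (by linarith))

theorem mul_pow_le_pow_sub_pow {x : ℝ} (hd : 0 ≤ d) (hx : d ≤ x) (m : ℕ) :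
    d * x ^ m ≤ x ^ (m + 1) - (x - d) ^ (m + 1) := by
  have hpow : (x - d) ^ m ≤ x ^ m := pow_le_pow_left₀ (by linarith) (by linarith) m
  have hmul : (x - d) * (x - d) ^ m ≤ (x - d) * x ^ m :=
    mul_le_mul_of_nonneg_left hpow (by linarith)
  rw [pow_succ', pow_succ']
  linarith

/-- A real function that is bounded on every compact interval, so that an estimate of its increments
`e x - e (x - d)` can be summed from a starting interval. -/
def LocallyBounded (e : ℝ → ℝ) : Prop :=
  ∀ s t : ℝ, ∃ B : ℝ, ∀ x ∈ Set.Icc s t, |e x| ≤ B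

namespace LocallyBounded

variable {e f : ℝ → ℝ} {m : ℕ}

theorem of_monotone (he : Monotone e) : LocallyBounded e :=
  fun s t => ⟨max |e s| |e t|, fun _ hx => abs_le_max_abs_abs (he hx.1) (he hx.2)⟩

theorem of_continuous (he : Continuous e) : LocallyBounded e :=
  fun _ _ => isCompact_Icc.exists_bound_of_continuousOn he.continuousOn

theorem sub (he : LocallyBounded e) (hf : LocallyBounded f) :
    LocallyBounded fun x => e x - f x := by
  intro s t
  obtain ⟨B, hB⟩ := he s t
  obtain ⟨C, hC⟩ := hf s t
  exact ⟨B + C, fun x hx => (abs_sub _ _).trans (add_le_add (hB x hx) (hC x hx))⟩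

theorem exists_forall_abs_le_add {A : ℝ → ℝ} {X : ℝ} (he : LocallyBounded e) (hd : 0 < d)
    (hA : ∀ x, X - d ≤ x → 0 ≤ A x)
    (hstep : ∀ x, X ≤ x → |e x - e (x - d)| ≤ A x - A (x - d)) :
    ∃ B, ∀ x, X ≤ x → |e x| ≤ A x + B := by
  obtain ⟨B, hB⟩ := he (X - d) X
  have key : ∀ x, X - d ≤ x → |e x| ≤ A x + B := by
    refine forall_of_forall_sub (X := X) hd (fun x hx hx' => ?_) fun x hx ih _ => ?_
    · linarith [hB x ⟨hx', hx.le⟩, hA x hx']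
    · have htri : |e x| - |e (x - d)| ≤ |e x - e (x - d)| := abs_sub_abs_le_abs_sub _ _
      linarith [ih (by linarith), hstep x hx]
  exact ⟨B, fun x hx => key x (by linarith)⟩

theorem exists_forall_abs_le_mul_pow_add {C X : ℝ} (he : LocallyBounded e) (hd : 0 < d)
    (hC : 0 ≤ C) (hX : d ≤ X)
    (hstep : ∀ x, X ≤ x → |e x - e (x - d)| ≤ C * d * (m * x ^ (m - 1))) :
    ∃ B, ∀ x, X ≤ x → |e x| ≤ C * m * x ^ m + B := by
  refine he.exists_forall_abs_le_add hd
    (fun x hx => mul_nonneg (by positivity) (pow_nonneg (by linarith) _))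
    fun x hx => (hstep x hx).trans ?_
  cases m with
  | zero => simp
  | succ m =>
    have hpow := mul_le_mul_of_nonneg_left (mul_pow_le_pow_sub_pow hd.le (hX.trans hx) m)
      (show 0 ≤ C * (m + 1 : ℕ) by positivity)
    rw [Nat.add_sub_cancel, ← mul_sub]
    linarith

theorem isBigO_pow_of_sub (he : LocallyBounded e) (hd : 0 < d)
    (h : (fun x => e x - e (x - d)) =O[atTop] fun x => (m : ℝ) * x ^ (m - 1)) :
    e =O[atTop] fun x => x ^ m := by
  obtain ⟨C, hC, hbound⟩ := h.exists_nonneg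
  obtain ⟨X, hX⟩ := eventually_atTop.1 hbound.bound
  obtain ⟨B, hB⟩ := he.exists_forall_abs_le_mul_pow_add (m := m) (C := C / d) (X := max X d) hd
    (by positivity) (le_max_right _ _) fun x hx => by
      have hx0 : 0 ≤ x := hd.le.trans ((le_max_right _ _).trans hx)
      rw [div_mul_cancel₀ C hd.ne']
      exact (hX x ((le_max_left _ _).trans hx)).trans_eq (by
        rw [Real.norm_of_nonneg (by positivity)])
  have hle : e =O[atTop] fun x => C / d * m * x ^ m + B := by
    refine IsBigO.of_bound' (eventually_atTop.2 ⟨max X d, fun x hx => ?_⟩)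
    exact (hB x hx).trans (le_abs_self _)
  refine hle.trans (((isBigO_refl _ _).const_mul_left _).add ?_)
  simpa using (isBigO_pow_atTop_of_le m.zero_le).const_mul_left B

theorem isLittleO_pow_of_sub (he : LocallyBounded e) (hd : 0 < d)
    (h : (fun x => e x - e (x - d)) =o[atTop] fun x => x ^ m) :
    e =o[atTop] fun x => x ^ (m + 1) := by
  refine IsLittleO.of_bound fun ε hε => ?_
  obtain ⟨X, hX⟩ := eventually_atTop.1
    (h.bound (show 0 < ε / 2 * d by positivity))
  obtain ⟨B, hB⟩ := he.exists_forall_abs_le_mul_pow_add (m := m + 1) (C := ε / 2 / (m + 1))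
    (X := max X d) hd (by positivity) (le_max_right _ _) fun x hx => by
      have hx0 : 0 ≤ x := hd.le.trans ((le_max_right _ _).trans hx)
      refine (hX x ((le_max_left _ _).trans hx)).trans_eq ?_
      rw [Real.norm_of_nonneg (by positivity), Nat.add_sub_cancel]
      push_cast
      field_simp
  have htop : Tendsto (fun x : ℝ => ε / 2 * x ^ (m + 1)) atTop atTop :=
    (tendsto_pow_atTop (Nat.succ_ne_zero m)).const_mul_atTop (by positivity)
  filter_upwards [eventually_ge_atTop (max X d), htop.eventually_ge_atTop B] with x hx hxB
  have hx0 : 0 ≤ x := hd.le.trans ((le_max_right _ _).trans hx)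
  rw [Real.norm_of_nonneg (pow_nonneg hx0 _)]
  refine (hB x hx).trans ?_
  push_cast
  rw [div_mul_cancel₀ _ (by positivity)]
  linarith

end LocallyBounded

end Increments

section DividedPow

/-- The divided power `x ^ n / n!`, the normalisation in which Taylor's formula has coefficients
`1`. -/
noncomputable def dividedPow (n : ℕ) (x : ℝ) : ℝ :=
  x ^ n / (n ! : ℝ)

theorem dividedPow_zero (x : ℝ) : dividedPow 0 x = 1 := by simp [dividedPow]

theorem continuous_dividedPow (n : ℕ) : Continuous (dividedPow n) :=
  (continuous_pow n).div_const _

theorem dividedPow_isBigO (n : ℕ) : dividedPow n =O[atTop] fun x : ℝ => x ^ n :=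
  ((isBigO_refl _ _).const_mul_left (n ! : ℝ)⁻¹).congr_left fun _ => (div_eq_inv_mul _ _).symm

theorem pow_isBigO_succ_mul_pow (n : ℕ) :
    (fun x : ℝ => x ^ n) =O[atTop] fun x : ℝ => ((n + 1 : ℕ) : ℝ) * x ^ n :=
  isBigO_self_const_mul (Nat.cast_ne_zero.2 n.succ_ne_zero) _ _

theorem natCast_mul_pow_sub_one_isLittleO (n : ℕ) :
    (fun x : ℝ => (n : ℝ) * x ^ (n - 1)) =o[atTop] fun x : ℝ => x ^ n := by
  cases n with
  | zero => simp
  | succ n => exact (isLittleO_pow_pow_atTop_of_lt n.lt_succ_self).const_mul_left _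

theorem dividedPow_sub (n : ℕ) (x s : ℝ) :
    dividedPow n (x - s) =
      ∑ i ∈ Finset.range (n + 1), dividedPow i (-s) * dividedPow (n - i) x := by
  rw [dividedPow, sub_eq_neg_add, add_pow, Finset.sum_div]
  refine Finset.sum_congr rfl fun i hi => ?_
  rw [Nat.cast_choose ℝ (Nat.lt_succ_iff.1 (Finset.mem_range.1 hi)), dividedPow, dividedPow]
  field_simp

/-- The gauge `n * x ^ (n - 1)` is `x ^ (n - 1)` up to a constant, but vanishes for `n = 0`, where
the Taylor polynomial is exact. -/
theorem dividedPow_sub_taylor_isBigO (n j : ℕ) (s : ℝ) :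
    (fun x => dividedPow (n + j) (x - s) -
        ∑ i ∈ Finset.range (j + 1), dividedPow i (-s) * dividedPow (n + j - i) x)
      =O[atTop] fun x => (n : ℝ) * x ^ (n - 1) := by
  have htail : ∀ x, dividedPow (n + j) (x - s) -
      ∑ i ∈ Finset.range (j + 1), dividedPow i (-s) * dividedPow (n + j - i) x =
      ∑ i ∈ Finset.range n, dividedPow (j + 1 + i) (-s) * dividedPow (n - 1 - i) x := by
    intro x
    rw [dividedPow_sub, show n + j + 1 = j + 1 + n by ring, Finset.sum_range_add,
      add_sub_cancel_left]
    refine Finset.sum_congr rfl fun i _ => ?_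
    congr 2
    omega
  simp only [htail]
  cases n with
  | zero => exact (isBigO_zero _ _).congr_left fun x => by simp
  | succ n =>
    refine IsBigO.fun_sum fun i _ => IsBigO.const_mul_left ?_ _
    exact ((dividedPow_isBigO _).trans (isBigO_pow_atTop_of_le (Nat.sub_le _ _))).trans
      (pow_isBigO_succ_mul_pow n)

theorem dividedPow_sub_sub_isBigO (n : ℕ) (s : ℝ) :
    (fun x => dividedPow n (x - s) - dividedPow n x) =O[atTop]
      fun x => (n : ℝ) * x ^ (n - 1) := by
  simpa [dividedPow] using dividedPow_sub_taylor_isBigO n 0 s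

theorem dividedPow_succ_sub_sub_isBigO (n : ℕ) (s : ℝ) :
    (fun x => dividedPow (n + 1) (x - s) - (dividedPow (n + 1) x - s * dividedPow n x))
      =O[atTop] fun x => (n : ℝ) * x ^ (n - 1) := by
  simpa [dividedPow, Finset.sum_range_succ, sub_eq_add_neg] using
    dividedPow_sub_taylor_isBigO n 1 s

theorem dividedPow_add_two_sub_sub_isBigO (n : ℕ) (s : ℝ) :
    (fun x => dividedPow (n + 2) (x - s) -
        (dividedPow (n + 2) x - s * dividedPow (n + 1) x + s ^ 2 / 2 * dividedPow n x))
      =O[atTop] fun x => (n : ℝ) * x ^ (n - 1) := by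
  simpa [dividedPow, Finset.sum_range_succ, sub_eq_add_neg] using
    dividedPow_sub_taylor_isBigO n 2 s

end DividedPow

section CesaroExpansion

open MeasureTheory

/-- `f` is monotone with leading term `a * x ^ n / n!`, and its primitive has in addition a second
term, so that `f` itself has a second term of degree `n - 1` on average. -/
structure HasCesaroExpansion (f : ℝ → ℝ) (n : ℕ) (a : ℝ) : Prop where
  monotone : Monotone f
  leading : (fun x => f x - a * dividedPow n x) =O[atTop] fun x => (n : ℝ) * x ^ (n - 1)
  primitive : ∃ b : ℝ, (fun T => (∫ x in (0 : ℝ)..T, f x) - a * dividedPow (n + 1) T -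
    b * dividedPow n T) =o[atTop] fun T => T ^ n

theorem exists_const_sub_mul_dividedPow_isLittleO (c : ℝ) (n : ℕ) :
    ∃ b : ℝ, (fun x => c - b * dividedPow n x) =o[atTop] fun x => x ^ n := by
  cases n with
  | zero => exact ⟨c, by simp [dividedPow_zero]⟩
  | succ n =>
    refine ⟨0, ?_⟩
    simpa using (isLittleO_pow_pow_atTop_of_lt (𝕜 := ℝ) n.succ_pos).const_mul_left c

theorem tendsto_sub_const_atTop (s : ℝ) : Tendsto (fun x : ℝ => x - s) atTop atTop :=
  tendsto_atTop_add_const_right atTop (-s) tendsto_id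

theorem sub_const_pow_isBigO (s : ℝ) (n : ℕ) :
    (fun x : ℝ => (x - s) ^ n) =O[atTop] fun x => x ^ n :=
  ((isBigO_refl _ _).sub (isLittleO_const_id_atTop s).isBigO).pow n

theorem integral_comp_sub_const {f : ℝ → ℝ} (hf : ∀ s t, IntervalIntegrable f volume s t)
    (s T : ℝ) :
    ∫ x in (0 : ℝ)..T, f (x - s) =
      (∫ x in (-s)..0, f x) + ∫ x in (0 : ℝ)..(T - s), f x := by
  rw [intervalIntegral.integral_comp_sub_right, zero_sub,
    intervalIntegral.integral_add_adjacent_intervals (hf _ _) (hf _ _)]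

namespace HasCesaroExpansion

variable {f g : ℝ → ℝ} {n : ℕ} {a a' : ℝ}

theorem intervalIntegrable (h : HasCesaroExpansion f n a) (s t : ℝ) :
    IntervalIntegrable f volume s t :=
  h.monotone.intervalIntegrable

theorem zero (n : ℕ) : HasCesaroExpansion (fun _ => 0) n 0 where
  monotone := monotone_const
  leading := (isBigO_zero _ _).congr_left fun x => by simp
  primitive := ⟨0, by simp⟩

theorem add (hf : HasCesaroExpansion f n a) (hg : HasCesaroExpansion g n a') :
    HasCesaroExpansion (fun x => f x + g x) n (a + a') where
  monotone := hf.monotone.add hg.monotone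
  leading := (hf.leading.add hg.leading).congr_left fun x => by ring
  primitive := by
    obtain ⟨b, hb⟩ := hf.primitive
    obtain ⟨b', hb'⟩ := hg.primitive
    refine ⟨b + b', (hb.add hb').congr_left fun T => ?_⟩
    rw [intervalIntegral.integral_add (hf.intervalIntegrable _ _) (hg.intervalIntegrable _ _)]
    ring

theorem succ (hf : HasCesaroExpansion f n a) : HasCesaroExpansion f (n + 1) 0 where
  monotone := hf.monotone
  leading := by
    have hrem := hf.leading.trans (natCast_mul_pow_sub_one_isLittleO n).isBigO
    refine ((hrem.add ((dividedPow_isBigO n).const_mul_left a)).trans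
      (pow_isBigO_succ_mul_pow n)).congr_left fun x => ?_
    ring
  primitive := by
    obtain ⟨b, hb⟩ := hf.primitive
    have hlt := isLittleO_pow_pow_atTop_of_lt (𝕜 := ℝ) n.lt_succ_self
    have hsecond := ((dividedPow_isBigO n).trans_isLittleO hlt).const_mul_left b
    exact ⟨a, ((hb.trans hlt).add hsecond).congr_left fun T => by ring⟩

theorem of_lt {m : ℕ} (hf : HasCesaroExpansion f n a) (h : n < m) :
    HasCesaroExpansion f m 0 := by
  induction m, h using Nat.le_induction with
  | base => exact hf.succ
  | succ m _ ih => exact ih.succ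

theorem comp_sub_const (hf : HasCesaroExpansion f n a) (s : ℝ) :
    HasCesaroExpansion (fun x => f (x - s)) n a where
  monotone := hf.monotone.comp fun x y hxy => sub_le_sub_right hxy s
  leading := by
    have hshift := (hf.leading.comp_tendsto (tendsto_sub_const_atTop s)).trans
      ((isBigO_refl (fun _ => (n : ℝ)) atTop).mul (sub_const_pow_isBigO s (n - 1)))
    refine (hshift.add ((dividedPow_sub_sub_isBigO n s).const_mul_left a)).congr_left fun x => ?_
    simp only [Function.comp_apply]
    ring
  primitive := by
    obtain ⟨b, hb⟩ := hf.primitive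
    obtain ⟨c, hc⟩ := exists_const_sub_mul_dividedPow_isLittleO (∫ x in (-s)..0, f x) n
    have hgauge := natCast_mul_pow_sub_one_isLittleO n
    have hshift := (hb.comp_tendsto (tendsto_sub_const_atTop s)).trans_isBigO
      (sub_const_pow_isBigO s n)
    have htaylor₁ := (dividedPow_succ_sub_sub_isBigO n s).trans_isLittleO hgauge
    have htaylor₀ := (dividedPow_sub_sub_isBigO n s).trans_isLittleO hgauge
    refine ⟨b + c - a * s, (((hshift.add hc).add (htaylor₁.const_mul_left a)).add
      (htaylor₀.const_mul_left b)).congr_left fun T => ?_⟩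
    rw [integral_comp_sub_const hf.intervalIntegrable]
    simp only [Function.comp_apply]
    ring

theorem leading_of_step {d : ℝ} (hd : 0 < d) (hf : Monotone f) (hg : HasCesaroExpansion g n a)
    (hfg : ∀ x, f x = g x + f (x - d)) :
    (fun x => f x - a / d * dividedPow (n + 1) x) =O[atTop] fun x => x ^ n := by
  have htaylor := dividedPow_succ_sub_sub_isBigO n d
  refine ((LocallyBounded.of_monotone hf).sub (.of_continuous
    ((continuous_dividedPow (n + 1)).const_mul (a / d)))).isBigO_pow_of_sub hd ?_
  refine (hg.leading.add (htaylor.const_mul_left (a / d))).congr_left fun x => ?_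
  rw [hfg x]
  field_simp
  ring

theorem integral_sub_integral_of_step {d : ℝ} (hd : 0 ≤ d) (hf : Monotone f)
    (hf0 : ∀ x < 0, f x = 0) (hg : ∀ s t, IntervalIntegrable g volume s t)
    (hfg : ∀ x, f x = g x + f (x - d)) (T : ℝ) :
    (∫ x in (0 : ℝ)..T, f x) - ∫ x in (0 : ℝ)..(T - d), f x = ∫ x in (0 : ℝ)..T, g x := by
  have hf_shift : Monotone fun x => f (x - d) := hf.comp fun x y hxy => sub_le_sub_right hxy d
  have hneg : ∫ x in (-d)..0, f x = 0 := by
    rw [intervalIntegral.integral_of_le (by linarith), integral_Ioc_eq_integral_Ioo]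
    exact setIntegral_eq_zero_of_forall_eq_zero fun x hx => hf0 x hx.2
  rw [intervalIntegral.integral_congr (g := fun x => g x + f (x - d)) fun x _ => hfg x,
    intervalIntegral.integral_add (hg _ _) hf_shift.intervalIntegrable,
    integral_comp_sub_const (fun _ _ => hf.intervalIntegrable), hneg]
  ring

theorem primitive_of_step {d : ℝ} (hd : 0 < d) (hf : Monotone f)
    (hf0 : ∀ x < 0, f x = 0) (hg : HasCesaroExpansion g n a) (hfg : ∀ x, f x = g x + f (x - d)) :
    ∃ b : ℝ, (fun T => (∫ x in (0 : ℝ)..T, f x) - a / d * dividedPow (n + 2) T -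
      b * dividedPow (n + 1) T) =o[atTop] fun T => T ^ (n + 1) := by
  obtain ⟨b, hb⟩ := hg.primitive
  have hgauge := natCast_mul_pow_sub_one_isLittleO n
  have htaylor₂ := (dividedPow_add_two_sub_sub_isBigO n d).trans_isLittleO hgauge
  have htaylor₁ := (dividedPow_succ_sub_sub_isBigO n d).trans_isLittleO hgauge
  have hF : LocallyBounded fun T => ∫ x in (0 : ℝ)..T, f x :=
    .of_continuous (intervalIntegral.continuous_primitive (fun _ _ => hf.intervalIntegrable) 0)
  have hpow (m : ℕ) (c : ℝ) : LocallyBounded fun x => c * dividedPow m x :=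
    .of_continuous ((continuous_dividedPow m).const_mul c)
  refine ⟨b / d + a / 2, ((hF.sub (hpow _ _)).sub (hpow _ _)).isLittleO_pow_of_sub hd ?_⟩
  refine ((hb.add (htaylor₂.const_mul_left (a / d))).add
    (htaylor₁.const_mul_left (b / d + a / 2))).congr_left fun T => ?_
  rw [← integral_sub_integral_of_step hd.le hf hf0 hg.intervalIntegrable hfg T]
  field_simp
  ring

theorem of_step {d : ℝ} (hd : 0 < d) (hf : Monotone f) (hf0 : ∀ x < 0, f x = 0)
    (hg : HasCesaroExpansion g n a) (hfg : ∀ x, f x = g x + f (x - d)) :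
    HasCesaroExpansion f (n + 1) (a / d) where
  monotone := hf
  leading := (leading_of_step hd hf hg hfg).trans (pow_isBigO_succ_mul_pow n)
  primitive := primitive_of_step hd hf hf0 hg hfg

theorem of_const_on_nonneg {c : ℝ} (hf : Monotone f) (hc : ∀ x, 0 ≤ x → f x = c) :
    HasCesaroExpansion f 0 c where
  monotone := hf
  leading := by
    refine EventuallyEq.trans_isBigO ?_ (isBigO_zero _ _)
    filter_upwards [eventually_ge_atTop 0] with x hx
    simp [hc x hx, dividedPow_zero]
  primitive := by
    refine ⟨0, EventuallyEq.trans_isLittleO ?_ (isLittleO_zero _ _)⟩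
    filter_upwards [eventually_ge_atTop 0] with T hT
    have hint : ∫ x in (0 : ℝ)..T, f x = ∫ _ in (0 : ℝ)..T, c := by
      refine intervalIntegral.integral_congr fun x hx => hc x ?_
      rw [Set.uIcc_of_le hT] at hx
      exact hx.1
    simp [hint, dividedPow, mul_comm]

theorem hasLeadingTerm (h : HasCesaroExpansion f n a) : HasLeadingTerm f n a := by
  refine (h.leading.congr_left fun x => ?_).trans ?_
  · rw [dividedPow, div_mul_eq_mul_div, mul_div_assoc]
  · cases n with
    | zero => exact (isBigO_zero _ _).congr_left fun x => by simp
    | succ n => simpa using isBigO_const_mul_self ((n : ℝ) + 1) (fun x : ℝ => x ^ n) atTop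

end HasCesaroExpansion

theorem twoTermRemainder_succ (f : ℝ → ℝ) (n : ℕ) (a b : ℝ) :
    twoTermRemainder f (n + 1) a b =
      fun x => f x - a * dividedPow (n + 1) x - b * dividedPow n x := by
  funext x
  simp only [twoTermRemainder, dividedPow, Nat.add_sub_cancel]
  ring

theorem integral_dividedPow (n : ℕ) (s t : ℝ) :
    ∫ x in s..t, dividedPow n x = dividedPow (n + 1) t - dividedPow (n + 1) s := by
  simp only [dividedPow, intervalIntegral.integral_div, integral_pow, Nat.factorial_succ]
  push_cast
  field_simp

namespace HasCesaroExpansion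

variable {f : ℝ → ℝ} {n : ℕ} {a : ℝ}

theorem exists_hasCesaroSecondTerm (h : HasCesaroExpansion f n a) :
    ∃ b : ℝ, 1 ≤ n → HasCesaroSecondTerm f n a b := by
  obtain _ | n := n
  · exact ⟨0, fun h => absurd h (by norm_num)⟩
  obtain ⟨b, hb⟩ := h.primitive
  have hpow (m : ℕ) (c s t : ℝ) :
      IntervalIntegrable (fun x => c * dividedPow m x) volume s t :=
    ((continuous_dividedPow m).const_mul c).intervalIntegrable s t
  have hlead (s t : ℝ) := (h.intervalIntegrable s t).sub (hpow (n + 1) a s t)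
  have hrem (s t : ℝ) : IntervalIntegrable (twoTermRemainder f (n + 1) a b) volume s t := by
    rw [twoTermRemainder_succ]
    exact (hlead s t).sub (hpow n b s t)
  have hint₀ (T : ℝ) : ∫ x in (0 : ℝ)..T, twoTermRemainder f (n + 1) a b x =
      (∫ x in (0 : ℝ)..T, f x) - a * dividedPow (n + 2) T - b * dividedPow (n + 1) T := by
    rw [twoTermRemainder_succ, intervalIntegral.integral_sub (hlead 0 T) (hpow n b 0 T),
      intervalIntegral.integral_sub (h.intervalIntegrable 0 T) (hpow (n + 1) a 0 T),
      intervalIntegral.integral_const_mul, intervalIntegral.integral_const_mul,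
      integral_dividedPow, integral_dividedPow]
    simp [dividedPow]
  have hconst := (isLittleO_pow_pow_atTop_of_lt (𝕜 := ℝ) n.succ_pos).const_mul_left
    (∫ x in (0 : ℝ)..1, twoTermRemainder f (n + 1) a b x)
  refine ⟨b, fun _ => ⟨fun T _ => hrem 1 T, ?_⟩⟩
  refine ((hb.sub hconst).tendsto_div_nhds_zero).congr fun T => ?_
  rw [← hint₀, pow_zero, mul_one,
    intervalIntegral.integral_interval_sub_left (hrem 0 T) (hrem 0 1), one_div_mul_eq_div]

end HasCesaroExpansion

end CesaroExpansion

section Graded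

open DirectSum

variable {ι σ τ R M : Type*} [CommRing R] [AddCommGroup M] [Module R M]

section Decomposition

variable [DecidableEq ι] [SetLike τ M] [AddSubmonoidClass τ M] (ℳ : ι → τ) [Decomposition ℳ]

theorem isHomogeneous_bot : (⊥ : Submodule R M).IsHomogeneous ℳ := by
  rintro i u rfl
  simp

variable {ℳ} in
theorem exists_mem_notMem_of_isHomogeneous {N : Submodule R M} (hN : N.IsHomogeneous ℳ)
    (hN_top : N ≠ ⊤) : ∃ δ, ∃ m ∈ ℳ δ, m ∉ N := by
  by_contra! h
  exact hN_top (eq_top_iff.2 fun u _ => (hN.mem_iff ℳ).2 fun i => h i _ (decompose ℳ u i).2)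

variable [AddCommGroup ι] [SetLike σ R] [AddSubmonoidClass σ R] (𝒜 : ι → σ) [GradedRing 𝒜]
  [SetLike.GradedSMul 𝒜 ℳ] {N : Submodule R M} {m : M} {δ : ι}

theorem decompose_smul_of_mem (r : R) (hm : m ∈ ℳ δ) (j : ι) :
    (decompose ℳ (r • m) j : M) = (decompose 𝒜 r (j - δ) : R) • m := by
  induction r using Decomposition.inductionOn 𝒜 with
  | zero => simp
  | @homogeneous i r =>
    have hrm : (r : R) • m ∈ ℳ (i + δ) := SetLike.GradedSMul.smul_mem r.2 hm
    by_cases hij : i + δ = j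
    · subst hij
      rw [decompose_of_mem_same ℳ hrm, add_sub_cancel_right, decompose_of_mem_same 𝒜 r.2]
    · rw [decompose_of_mem_ne ℳ hrm hij,
        decompose_of_mem_ne 𝒜 r.2 fun h => hij (eq_sub_iff_add_eq.1 h), zero_smul]
  | add r s hr hs =>
    simp only [add_smul, decompose_add, DirectSum.add_apply, AddMemClass.coe_add, hr, hs]

theorem exists_decompose_sub_smul_mem (hN : N.IsHomogeneous ℳ) (hm : m ∈ ℳ δ) (i : ι) {u : M}
    (hu : u ∈ N ⊔ R ∙ m) : ∃ r ∈ 𝒜 (i - δ), (decompose ℳ u i : M) - r • m ∈ N := by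
  obtain ⟨v, hv, w, hw, rfl⟩ := Submodule.mem_sup.1 hu
  obtain ⟨r, rfl⟩ := Submodule.mem_span_singleton.1 hw
  refine ⟨_, (decompose 𝒜 r (i - δ)).2, ?_⟩
  rw [decompose_add, DirectSum.add_apply, AddMemClass.coe_add, decompose_smul_of_mem ℳ 𝒜 r hm,
    add_sub_cancel_right]
  exact hN i hv

include 𝒜 in
theorem isHomogeneous_sup_span_singleton (hN : N.IsHomogeneous ℳ) (hm : m ∈ ℳ δ) :
    (N ⊔ R ∙ m).IsHomogeneous ℳ := by
  intro i u hu
  obtain ⟨r, -, hr⟩ := exists_decompose_sub_smul_mem ℳ 𝒜 hN hm i hu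
  rw [← sub_add_cancel (decompose ℳ u i : M) (r • m)]
  exact add_mem (Submodule.mem_sup_left hr)
    (Submodule.mem_sup_right (Submodule.smul_mem _ _ (Submodule.mem_span_singleton_self m)))

theorem isHomogeneous_colon_singleton (hN : N.IsHomogeneous ℳ) (hm : m ∈ ℳ δ) :
    Submodule.IsHomogeneous (N.colon {m}) 𝒜 := by
  intro i r hr
  rw [Submodule.mem_colon_singleton] at hr ⊢
  have hi := hN (i + δ) hr
  rwa [decompose_smul_of_mem ℳ 𝒜 r hm, add_sub_cancel_right] at hi

end Decomposition

variable [AddCommGroup ι] [LinearOrder ι] [IsOrderedAddMonoid ι] [SetLike σ R]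
  [AddSubmonoidClass σ R] (𝒜 : ι → σ) [GradedRing 𝒜] [SetLike τ M] [AddSubmonoidClass τ M]
  (ℳ : ι → τ) [Decomposition ℳ] [SetLike.GradedSMul 𝒜 ℳ]

include 𝒜 in
/-- A maximal element among the colon ideals `N.colon {m}`, with `m ∉ N` homogeneous, is prime. -/
theorem exists_isPrime_colon_singleton [IsNoetherianRing R] {N : Submodule R M}
    (hN : N.IsHomogeneous ℳ) (hN_top : N ≠ ⊤) :
    ∃ δ, ∃ m ∈ ℳ δ, m ∉ N ∧ (N.colon {m}).IsPrime := by
  obtain ⟨δ₀, m₀, hm₀, hm₀N⟩ := exists_mem_notMem_of_isHomogeneous hN hN_top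
  let S : Set (Ideal R) := {I | ∃ δ, ∃ m ∈ ℳ δ, m ∉ N ∧ I = N.colon {m}}
  obtain ⟨_, ⟨δ, m, hm, hmN, rfl⟩, hmax⟩ :=
    set_has_maximal_iff_noetherian.2 ‹_› S ⟨_, δ₀, m₀, hm₀, hm₀N, rfl⟩
  refine ⟨δ, m, hm, hmN, Ideal.IsHomogeneous.isPrime_of_homogeneous_mem_or_mem (𝒜 := 𝒜)
    (isHomogeneous_colon_singleton ℳ 𝒜 hN hm) ?_ ?_⟩
  · rwa [Ideal.ne_top_iff_one, Submodule.mem_colon_singleton, one_smul]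
  · rintro r s ⟨i, hr⟩ - hrs
    by_contra! hnot
    obtain ⟨hrN, hsN⟩ := hnot
    rw [Submodule.mem_colon_singleton] at hrN hrs
    have hle : N.colon {m} ≤ N.colon {r • m} := fun t ht => by
      rw [Submodule.mem_colon_singleton] at ht ⊢
      rw [smul_comm]
      exact N.smul_mem r ht
    have hs : s ∈ N.colon {r • m} := by
      rwa [Submodule.mem_colon_singleton, smul_smul, mul_comm]
    exact hmax _ ⟨i + δ, r • m, SetLike.GradedSMul.smul_mem hr hm, hrN, rfl⟩
      (lt_of_le_not_ge hle fun hge => hsN (hge hs))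

include 𝒜 in
theorem homogeneous_submodule_induction [IsNoetherianRing R] [Module.Finite R M]
    {motive : Submodule R M → Prop} {N : Submodule R M} (hN : N.IsHomogeneous ℳ) (top : motive ⊤)
    (step : ∀ (N' : Submodule R M) (δ : ι) (m : M), N ≤ N' → N'.IsHomogeneous ℳ → m ∈ ℳ δ →
      (N'.colon {m}).IsPrime → motive (N' ⊔ R ∙ m) → motive N') :
    motive N := by
  suffices ∀ N', N ≤ N' → N'.IsHomogeneous ℳ → motive N' from this N le_rfl hN
  intro N'
  induction N' using WellFoundedGT.induction with
  | ind N' ih =>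
    intro hle hN'
    by_cases htop : N' = ⊤
    · exact htop ▸ top
    obtain ⟨δ, m, hm, hmN', hprime⟩ := exists_isPrime_colon_singleton 𝒜 ℳ hN' htop
    have hlt : N' < N' ⊔ R ∙ m := Submodule.lt_sup_iff_notMem.2 hmN'
    exact step N' δ m hle hN' hm hprime
      (ih _ hlt (hle.trans hlt.le) (isHomogeneous_sup_span_singleton ℳ 𝒜 hN' hm))

end Graded

section Colon

variable {R M : Type*} [CommRing R] [AddCommGroup M] [Module R M]

/-- Multiplication by `m`, as a map `R ⧸ (N : m) → M ⧸ N`; its image is `(N + R m) ⧸ N`. -/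
def colonQuotientMap (N : Submodule R M) (m : M) : (R ⧸ N.colon {m}) →ₗ[R] (M ⧸ N) :=
  Submodule.mapQ (N.colon {m}) N (LinearMap.toSpanSingleton R M m) fun r hr => by
    simpa [Submodule.mem_colon_singleton] using hr

theorem colonQuotientMap_mkQ (N : Submodule R M) (m : M) (r : R) :
    colonQuotientMap N m ((N.colon {m}).mkQ r) = N.mkQ (r • m) := rfl

theorem colonQuotientMap_injective (N : Submodule R M) (m : M) :
    Function.Injective (colonQuotientMap N m) := by
  refine (injective_iff_map_eq_zero _).2 fun y hy => ?_
  obtain ⟨r, rfl⟩ := Submodule.mkQ_surjective _ y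
  rw [colonQuotientMap_mkQ, Submodule.mkQ_apply, Submodule.Quotient.mk_eq_zero] at hy
  exact (Submodule.Quotient.mk_eq_zero _).2 (Submodule.mem_colon_singleton.2 hy)

theorem range_colonQuotientMap (N : Submodule R M) (m : M) :
    LinearMap.range (colonQuotientMap N m) =
      LinearMap.ker (Submodule.factor (le_sup_left : N ≤ N ⊔ R ∙ m)) := by
  rw [colonQuotientMap, Submodule.range_mapQ, LinearMap.range_toSpanSingleton, Submodule.factor,
    Submodule.ker_mapQ, Submodule.comap_id, Submodule.map_sup, Submodule.mkQ_map_self, bot_sup_eq]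

theorem colon_singleton_eq_self {p : Ideal R} (hp : p.IsPrime) {f : R} (hf : f ∉ p) :
    Submodule.colon p {f} = p := by
  ext r
  rw [Submodule.mem_colon_singleton, smul_eq_mul]
  exact ⟨fun hr => (hp.mem_or_mem hr).resolve_right hf, p.mul_mem_right f⟩

theorem finrank_quotient_eq_add_finrank_quotient_colon [IsDomain R] [Module.Finite R M]
    (N : Submodule R M) (m : M) :
    Module.finrank R (M ⧸ N) =
      Module.finrank R (M ⧸ (N ⊔ R ∙ m)) + Module.finrank R (R ⧸ N.colon {m}) := by
  let π := Submodule.factor (le_sup_left : N ≤ N ⊔ R ∙ m)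
  have hsurj : Function.Surjective π := Submodule.factor_surjective _
  rw [← Submodule.finrank_quotient_add_finrank (LinearMap.ker π),
    (π.quotKerEquivOfSurjective hsurj).finrank_eq, ← range_colonQuotientMap,
    LinearMap.finrank_range_of_inj (colonQuotientMap_injective N m)]

theorem finrank_quotient_ideal_eq_zero [IsDomain R] {I : Ideal R} (hI : I ≠ ⊥) :
    Module.finrank R (R ⧸ I) = 0 := by
  obtain ⟨r, hr, hr0⟩ := Submodule.exists_mem_ne_zero_of_ne_bot hI
  refine Module.finrank_eq_zero_iff_isTorsion.2 fun y => ?_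
  obtain ⟨s, rfl⟩ := Submodule.mkQ_surjective _ y
  exact ⟨⟨r, mem_nonZeroDivisors_of_ne_zero hr0⟩,
    (Submodule.Quotient.mk_eq_zero I).2 (I.mul_mem_right s hr)⟩

end Colon

section FinrankAddition

variable {k V W : Type*} [DivisionRing k] [AddCommGroup V] [Module k V] [AddCommGroup W]
  [Module k W]

theorem finrank_eq_finrank_map_add_finrank_inf_ker (f : V →ₗ[k] W) (U : Submodule k V)
    [FiniteDimensional k U] :
    Module.finrank k U =
      Module.finrank k (U.map f) + Module.finrank k ↥(U ⊓ LinearMap.ker f) := by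
  rw [← LinearMap.finrank_range_add_finrank_ker (f.domRestrict U), LinearMap.range_domRestrict,
    LinearMap.ker_domRestrict, ← Submodule.map_comap_subtype,
    (Submodule.equivMapOfInjective U.subtype U.injective_subtype _).finrank_eq]

end FinrankAddition

section GradedLE

variable {k M : Type*} [Field k] [AddCommGroup M] [Module k M] {ℳ : ℝ → Submodule k M}

theorem le_gradedLE {l x : ℝ} (h : l ≤ x) : ℳ l ≤ gradedLE ℳ x :=
  le_iSup₂_of_le l h le_rfl

theorem gradedLE_mono : Monotone (gradedLE ℳ) := fun _ _ hxy =>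
  iSup₂_le fun _ hl => le_gradedLE (hl.trans hxy)

theorem gradedLE_eq_bot (h_neg : ∀ γ < 0, ℳ γ = ⊥) {x : ℝ} (hx : x < 0) : gradedLE ℳ x = ⊥ :=
  eq_bot_iff.2 (iSup₂_le fun l hl => (h_neg l (hl.trans_lt hx)).le)

theorem decompose_eq_zero_of_mem_gradedLE [DirectSum.Decomposition ℳ] {x i : ℝ} {u : M}
    (hu : u ∈ gradedLE ℳ x) (hi : x < i) : (DirectSum.decompose ℳ u i : M) = 0 := by
  suffices gradedLE ℳ x ≤ LinearMap.ker ((ℳ i).subtype ∘ₗ DirectSum.component k ℝ _ i ∘ₗ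
      (DirectSum.decomposeLinearEquiv ℳ).toLinearMap) from this hu
  exact iSup₂_le fun l hl v hv => DirectSum.decompose_of_mem_ne ℳ hv (hl.trans_lt hi).ne

end GradedLE

section QuotientLE

variable {k R M : Type*} [Field k] [CommRing R] [Algebra k R] [AddCommGroup M] [Module k M]
  [Module R M] [IsScalarTower k R M]

/-- `(M / N)_{≤ x}`, the image of `M_{≤ x}` in `M / N`; it does not require `M / N` to be equipped
with a grading. -/
def quotientLE (ℳ : ℝ → Submodule k M) (N : Submodule R M) (x : ℝ) : Submodule k (M ⧸ N) :=
  (gradedLE ℳ x).map (N.mkQ.restrictScalars k)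

variable {ℳ : ℝ → Submodule k M} {N N' : Submodule R M}

theorem quotientLE_mono : Monotone (quotientLE ℳ N) :=
  fun _ _ hxy => Submodule.map_mono (gradedLE_mono hxy)

theorem quotientLE_eq_bot (h_neg : ∀ γ < 0, ℳ γ = ⊥) {x : ℝ} (hx : x < 0) :
    quotientLE ℳ N x = ⊥ := by
  rw [quotientLE, gradedLE_eq_bot h_neg hx, Submodule.map_bot]

theorem map_factor_quotientLE (h : N ≤ N') (x : ℝ) :
    (quotientLE ℳ N x).map ((Submodule.factor h).restrictScalars k) = quotientLE ℳ N' x := by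
  rw [quotientLE, quotientLE, ← Submodule.map_comp, ← LinearMap.restrictScalars_comp,
    Submodule.factor_comp_mk]

variable (R ℳ) in
/-- The identification `(M / 0)_{≤ x} ≃ M_{≤ x}`. -/
noncomputable def quotientLEBotEquiv (x : ℝ) :
    quotientLE ℳ (⊥ : Submodule R M) x ≃ₗ[k] gradedLE ℳ x :=
  (Submodule.equivMapOfInjective ((⊥ : Submodule R M).mkQ.restrictScalars k)
    (LinearMap.ker_eq_bot.1 (Submodule.ker_mkQ _) : Function.Injective (⊥ : Submodule R M).mkQ)
    _).symm

variable {𝒜 : ℝ → Submodule k R} [SetLike.GradedSMul 𝒜 ℳ] {m : M} {δ : ℝ}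

theorem smul_mem_gradedLE {r : R} {x : ℝ} (hr : r ∈ gradedLE 𝒜 (x - δ)) (hm : m ∈ ℳ δ) :
    r • m ∈ gradedLE ℳ x := by
  suffices gradedLE 𝒜 (x - δ) ≤
      (gradedLE ℳ x).comap ((LinearMap.toSpanSingleton R M m).restrictScalars k) from this hr
  exact iSup₂_le fun l hl s hs =>
    le_gradedLE (le_sub_iff_add_le.1 hl) (SetLike.GradedSMul.smul_mem hs hm)

variable [GradedAlgebra 𝒜] [DirectSum.Decomposition ℳ]

theorem quotientLE_inf_ker_factor (hN : N.IsHomogeneous ℳ) (hm : m ∈ ℳ δ) (x : ℝ) :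
    quotientLE ℳ N x ⊓ LinearMap.ker
        ((Submodule.factor (le_sup_left : N ≤ N ⊔ R ∙ m)).restrictScalars k) =
      (quotientLE 𝒜 (N.colon {m}) (x - δ)).map ((colonQuotientMap N m).restrictScalars k) := by
  classical
  apply le_antisymm
  · rintro _ ⟨⟨u, hu, rfl⟩, hker⟩
    have hu_sup : u ∈ N ⊔ R ∙ m := (Submodule.Quotient.mk_eq_zero _).1 hker
    rw [← DirectSum.sum_support_decompose ℳ u, map_sum]
    refine sum_mem fun i hi => ?_
    have hix : i ≤ x := by
      by_contra! h
      exact DFinsupp.mem_support_iff.1 hi (Subtype.ext (decompose_eq_zero_of_mem_gradedLE hu h))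
    obtain ⟨r, hr, hrN⟩ := exists_decompose_sub_smul_mem ℳ 𝒜 hN hm i hu_sup
    exact ⟨_, ⟨r, le_gradedLE (sub_le_sub_right hix δ) hr, rfl⟩,
      ((Submodule.Quotient.eq N).2 hrN).symm⟩
  · rintro _ ⟨_, ⟨r, hr, rfl⟩, rfl⟩
    exact ⟨⟨r • m, smul_mem_gradedLE hr hm, rfl⟩,
      (range_colonQuotientMap N m).le (LinearMap.mem_range_self _ _)⟩

theorem finite_quotientLE_of_colon (hN : N.IsHomogeneous ℳ) (hm : m ∈ ℳ δ) {x : ℝ}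
    [Module.Finite k (quotientLE ℳ (N ⊔ R ∙ m) x)]
    [Module.Finite k (quotientLE 𝒜 (N.colon {m}) (x - δ))] :
    Module.Finite k (quotientLE ℳ N x) := by
  refine Module.Finite.iff_fg.2 (Submodule.fg_of_fg_map_of_fg_inf_ker
    ((Submodule.factor (le_sup_left : N ≤ N ⊔ R ∙ m)).restrictScalars k) ?_ ?_)
  · rw [map_factor_quotientLE]
    exact Module.Finite.iff_fg.1 ‹_›
  · rw [quotientLE_inf_ker_factor (𝒜 := 𝒜) hN hm]
    exact (Module.Finite.iff_fg.1 ‹_›).map _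

theorem finrank_quotientLE_eq_add (hN : N.IsHomogeneous ℳ) (hm : m ∈ ℳ δ) (x : ℝ)
    [Module.Finite k (quotientLE ℳ N x)] :
    Module.finrank k (quotientLE ℳ N x) = Module.finrank k (quotientLE ℳ (N ⊔ R ∙ m) x) +
      Module.finrank k (quotientLE 𝒜 (N.colon {m}) (x - δ)) := by
  rw [finrank_eq_finrank_map_add_finrank_inf_ker
    ((Submodule.factor (le_sup_left : N ≤ N ⊔ R ∙ m)).restrictScalars k) (quotientLE ℳ N x),
    map_factor_quotientLE, quotientLE_inf_ker_factor (𝒜 := 𝒜) hN hm,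
    (Submodule.equivMapOfInjective ((colonQuotientMap N m).restrictScalars k)
      (colonQuotientMap_injective N m) _).finrank_eq]

end QuotientLE

section HilbertExpansion

variable {k R M : Type*} [Field k] [CommRing R] [Algebra k R] [AddCommGroup M] [Module k M]
  [Module R M] [IsScalarTower k R M]

/-- The quotient `M / N` has a Hilbert function `x ↦ dim (M / N)_{≤ x}` with finite values, leading
term `a * x ^ n / n!` and, on average, a second term. -/
structure HasHilbertExpansion (ℳ : ℝ → Submodule k M) (N : Submodule R M) (n : ℕ) (a : ℝ) :
    Prop where
  finite (x : ℝ) : Module.Finite k (quotientLE ℳ N x)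
  expansion : HasCesaroExpansion (fun x => (Module.finrank k (quotientLE ℳ N x) : ℝ)) n a

theorem finrank_quotientLE_mono {ℳ : ℝ → Submodule k M} {N : Submodule R M}
    (h : ∀ x, Module.Finite k (quotientLE ℳ N x)) :
    Monotone fun x => (Module.finrank k (quotientLE ℳ N x) : ℝ) := fun _ y hxy =>
  have := h y
  Nat.cast_le.2 (Submodule.finrank_mono (quotientLE_mono hxy))

namespace HasHilbertExpansion

variable {ℳ : ℝ → Submodule k M} {N : Submodule R M} {n : ℕ} {a a' : ℝ}

theorem of_lt {m : ℕ} (h : HasHilbertExpansion ℳ N n a) (hnm : n < m) :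
    HasHilbertExpansion ℳ N m 0 :=
  ⟨h.finite, h.expansion.of_lt hnm⟩

theorem top (ℳ : ℝ → Submodule k M) (n : ℕ) :
    HasHilbertExpansion ℳ (⊤ : Submodule R M) n 0 where
  finite _ := inferInstance
  expansion := by
    simpa only [Module.finrank_zero_of_subsingleton, Nat.cast_zero] using
      HasCesaroExpansion.zero n

theorem of_forall_pos_le [Module.Finite k (ℳ 0)] (h_neg : ∀ γ < 0, ℳ γ = ⊥)
    (h_pos : ∀ γ, 0 < γ → ∀ u ∈ ℳ γ, u ∈ N) :
    HasHilbertExpansion ℳ N 0 (Module.finrank k ((ℳ 0).map (N.mkQ.restrictScalars k))) := by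
  have hle (x : ℝ) : quotientLE ℳ N x ≤ (ℳ 0).map (N.mkQ.restrictScalars k) := by
    refine Submodule.map_le_iff_le_comap.2 (iSup₂_le fun γ _ u hu => ?_)
    rcases lt_trichotomy γ 0 with hγ | rfl | hγ
    · rw [h_neg γ hγ, Submodule.mem_bot] at hu
      exact hu ▸ zero_mem _
    · exact Submodule.mem_map_of_mem hu
    · exact ⟨0, zero_mem _, ((Submodule.Quotient.mk_eq_zero N).2 (h_pos γ hγ u hu)).symm⟩
  have hfin (x : ℝ) : Module.Finite k (quotientLE ℳ N x) :=
    Submodule.finiteDimensional_of_le (hle x)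
  refine ⟨hfin, .of_const_on_nonneg (finrank_quotientLE_mono hfin) fun x hx => ?_⟩
  rw [(hle x).antisymm (Submodule.map_mono (le_gradedLE hx))]

theorem finite_gradedLE (h : HasHilbertExpansion ℳ (⊥ : Submodule R M) n a) (x : ℝ) :
    Module.Finite k (gradedLE ℳ x) :=
  have := h.finite x
  .equiv (quotientLEBotEquiv R ℳ x)

theorem hasCesaroExpansion_dimLE (h : HasHilbertExpansion ℳ (⊥ : Submodule R M) n a) :
    HasCesaroExpansion (dimLE ℳ) n a := by
  have hdim (x : ℝ) : (Module.finrank k (quotientLE ℳ (⊥ : Submodule R M) x) : ℝ) = dimLE ℳ x :=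
    congrArg Nat.cast (quotientLEBotEquiv R ℳ x).finrank_eq
  simpa only [hdim] using h.expansion

variable {𝒜 : ℝ → Submodule k R} [GradedAlgebra 𝒜] [DirectSum.Decomposition ℳ]
  [SetLike.GradedSMul 𝒜 ℳ]

theorem of_colon (hN : N.IsHomogeneous ℳ) {m : M} {δ : ℝ} (hm : m ∈ ℳ δ)
    (h : HasHilbertExpansion ℳ (N ⊔ R ∙ m) n a)
    (h' : HasHilbertExpansion 𝒜 (N.colon {m}) n a') : HasHilbertExpansion ℳ N n (a + a') := by
  have hfin (x : ℝ) : Module.Finite k (quotientLE ℳ N x) :=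
    have := h.finite x
    have := h'.finite (x - δ)
    finite_quotientLE_of_colon (𝒜 := 𝒜) hN hm
  refine ⟨hfin, ?_⟩
  simpa only [← Nat.cast_add, ← finrank_quotientLE_eq_add (𝒜 := 𝒜) hN hm] using
    h.expansion.add (h'.expansion.comp_sub_const δ)

theorem of_sup_span_singleton (h_neg : ∀ γ < 0, 𝒜 γ = ⊥) {p : Ideal R} (hp : p.IsPrime)
    (hp_hom : Submodule.IsHomogeneous p 𝒜) {d : ℝ} (hd : 0 < d) {f : R} (hf : f ∈ 𝒜 d)
    (hfp : f ∉ p) (h : HasHilbertExpansion 𝒜 (p ⊔ R ∙ f) n a) :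
    HasHilbertExpansion 𝒜 p (n + 1) (a / d) := by
  have hcolon := colon_singleton_eq_self hp hfp
  have hfin : ∀ x, Module.Finite k (quotientLE 𝒜 p x) := by
    refine forall_of_forall_sub (X := 0) hd (fun x hx => ?_) fun x _ hxd => ?_
    · rw [quotientLE_eq_bot h_neg hx]
      infer_instance
    · rw [← hcolon] at hxd
      have := h.finite x
      exact finite_quotientLE_of_colon (𝒜 := 𝒜) hp_hom hf
  refine ⟨hfin, .of_step hd (finrank_quotientLE_mono hfin) (fun x hx => ?_) h.expansion
    fun x => ?_⟩
  · rw [quotientLE_eq_bot h_neg hx, finrank_bot, Nat.cast_zero]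
  · rw [finrank_quotientLE_eq_add (𝒜 := 𝒜) hp_hom hf x, hcolon, Nat.cast_add]

theorem exists_of_forall_colon [IsNoetherianRing R] [Module.Finite R M] (hN : N.IsHomogeneous ℳ)
    (h : ∀ (N' : Submodule R M) (δ : ℝ) (m : M), N ≤ N' → N'.IsHomogeneous ℳ → m ∈ ℳ δ →
      (N'.colon {m}).IsPrime → ∃ a, HasHilbertExpansion 𝒜 (N'.colon {m}) n a) :
    ∃ a, HasHilbertExpansion ℳ N n a := by
  refine homogeneous_submodule_induction 𝒜 ℳ (motive := fun N => ∃ a, HasHilbertExpansion ℳ N n a)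
    hN ⟨0, top ℳ n⟩ ?_
  rintro N' δ m hle hN' hm hprime ⟨a, ha⟩
  obtain ⟨a', ha'⟩ := h N' δ m hle hN' hm hprime
  exact ⟨a + a', of_colon hN' hm ha ha'⟩

end HasHilbertExpansion

end HilbertExpansion

section Dimension

variable {k R : Type*} [Field k] [CommRing R] [Algebra k R] {𝒜 : ℝ → Submodule k R}
  [GradedAlgebra 𝒜]

theorem sup_span_singleton_ne_top (h_neg : ∀ γ < 0, 𝒜 γ = ⊥) {p : Ideal R}
    (hp : Submodule.IsHomogeneous p 𝒜) (hp_top : p ≠ ⊤) {d : ℝ} (hd : 0 < d) {f : R}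
    (hf : f ∈ 𝒜 d) : p ⊔ R ∙ f ≠ ⊤ := by
  intro htop
  obtain ⟨r, hr, hrp⟩ := exists_decompose_sub_smul_mem 𝒜 𝒜 hp hf 0
    (htop ▸ Submodule.mem_top : (1 : R) ∈ p ⊔ R ∙ f)
  rw [h_neg _ (by linarith), Submodule.mem_bot] at hr
  rw [hr, zero_smul, sub_zero,
    DirectSum.decompose_of_mem_same 𝒜 SetLike.GradedOne.one_mem] at hrp
  exact hp_top ((Ideal.eq_top_iff_one p).2 hrp)

theorem homogeneous_mem_asIdeal_of_isMax (h_neg : ∀ γ < 0, 𝒜 γ = ⊥) {p : PrimeSpectrum R}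
    (hp : Submodule.IsHomogeneous p.asIdeal 𝒜) (hmax : IsMax p) {d : ℝ} (hd : 0 < d) {f : R}
    (hf : f ∈ 𝒜 d) : f ∈ p.asIdeal := by
  obtain ⟨q, hq, hle⟩ := Ideal.exists_le_maximal _
    (sup_span_singleton_ne_top h_neg hp p.isPrime.ne_top hd hf)
  have hqp : q ≤ p.asIdeal :=
    hmax (b := ⟨q, hq.isPrime⟩) (le_sup_left.trans hle : p.asIdeal ≤ q)
  exact hqp (hle (Submodule.mem_sup_right (Submodule.mem_span_singleton_self f)))

theorem lt_colon_of_sup_span_singleton_le {p : PrimeSpectrum R} {f : R} (hf : f ∉ p.asIdeal)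
    {I : Ideal R} (hI : p.asIdeal ⊔ R ∙ f ≤ I) {m : R} (hq : (I.colon {m}).IsPrime) :
    p < ⟨I.colon {m}, hq⟩ := by
  have hle : p.asIdeal ⊔ R ∙ f ≤ I.colon {m} := hI.trans fun r hr =>
    Submodule.mem_colon_singleton.2 (I.mul_mem_right m hr)
  refine lt_of_le_not_ge (le_sup_left.trans hle : p.asIdeal ≤ _) fun hge => hf (hge (hle ?_))
  exact Submodule.mem_sup_right (Submodule.mem_span_singleton_self f)

theorem exists_hasHilbertExpansion_of_coheight_le [IsNoetherianRing R] [Module.Finite k (𝒜 0)]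
    (h_neg : ∀ γ < 0, 𝒜 γ = ⊥) {p : PrimeSpectrum R}
    (hp : Submodule.IsHomogeneous p.asIdeal 𝒜) {n : ℕ} (hn : Order.coheight p ≤ n) :
    ∃ a, HasHilbertExpansion 𝒜 p.asIdeal n a := by
  induction n generalizing p with
  | zero =>
    have hmax : IsMax p := Order.coheight_eq_zero.1 (nonpos_iff_eq_zero.1 (by simpa using hn))
    exact ⟨_, .of_forall_pos_le h_neg fun _ hd _ hf =>
      homogeneous_mem_asIdeal_of_isMax h_neg hp hmax hd hf⟩
  | succ n ih =>
    by_cases h_pos : ∀ d, 0 < d → ∀ f ∈ 𝒜 d, f ∈ p.asIdeal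
    · exact ⟨0, (HasHilbertExpansion.of_forall_pos_le h_neg h_pos).of_lt n.succ_pos⟩
    push Not at h_pos
    obtain ⟨d, hd, f, hf, hfp⟩ := h_pos
    suffices ∃ a, HasHilbertExpansion 𝒜 (p.asIdeal ⊔ R ∙ f) n a by
      obtain ⟨a, ha⟩ := this
      exact ⟨_, ha.of_sup_span_singleton h_neg p.isPrime hp hd hf hfp⟩
    refine HasHilbertExpansion.exists_of_forall_colon (𝒜 := 𝒜)
      (isHomogeneous_sup_span_singleton 𝒜 𝒜 hp hf) fun I δ m hI hI_hom hm hq => ?_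
    have hcoheight := Order.coheight_le_coe_iff.1 hn _ (lt_colon_of_sup_span_singleton_le hfp hI hq)
    exact ih (p := ⟨I.colon {m}, hq⟩) (isHomogeneous_colon_singleton 𝒜 𝒜 hI_hom hm)
      (Order.le_of_lt_succ (by simpa [Order.succ_eq_add_one] using hcoheight))

theorem coheight_le_of_ringKrullDim_le {n : ℕ} (hn : ringKrullDim R ≤ n) (p : PrimeSpectrum R) :
    Order.coheight p ≤ n := by
  exact_mod_cast (Order.coheight_le_krullDim p).trans hn

end Dimension

section Rank

variable {k R M : Type*} [Field k] [CommRing R] [IsDomain R] [IsNoetherianRing R] [Algebra k R]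
  {𝒜 : ℝ → Submodule k R} [GradedAlgebra 𝒜] [Module.Finite k (𝒜 0)] {n : ℕ} {a : ℝ}

theorem hasHilbertExpansion_of_isPrime (h_neg : ∀ γ < 0, 𝒜 γ = ⊥) (hn : ringKrullDim R ≤ n)
    (ha : HasHilbertExpansion 𝒜 (⊥ : Ideal R) n a) {q : Ideal R} (hq : q.IsPrime)
    (hq_hom : Submodule.IsHomogeneous q 𝒜) :
    HasHilbertExpansion 𝒜 q n (Module.finrank R (R ⧸ q) * a) := by
  obtain rfl | hq_bot := eq_or_ne q ⊥
  · simpa only [(Submodule.quotEquivOfEqBot (⊥ : Ideal R) rfl).finrank_eq, Module.finrank_self,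
      Nat.cast_one, one_mul] using ha
  rw [finrank_quotient_ideal_eq_zero hq_bot, Nat.cast_zero, zero_mul]
  have hlt : (⊥ : PrimeSpectrum R) < ⟨q, hq⟩ :=
    bot_lt_iff_ne_bot.2 fun h => hq_bot (congrArg PrimeSpectrum.asIdeal h)
  have hcoheight := Order.coheight_le_coe_iff.1 (coheight_le_of_ringKrullDim_le hn ⊥) _ hlt
  obtain ⟨c, hc⟩ := ENat.ne_top_iff_exists.1 hcoheight.ne_top
  rw [← hc, Nat.cast_lt] at hcoheight
  obtain ⟨_, h⟩ := exists_hasHilbertExpansion_of_coheight_le h_neg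
    (p := ⟨q, hq⟩) hq_hom hc.ge
  exact h.of_lt hcoheight

variable [AddCommGroup M] [Module k M] [Module R M] [IsScalarTower k R M] [Module.Finite R M]
  {ℳ : ℝ → Submodule k M} [DirectSum.Decomposition ℳ] [SetLike.GradedSMul 𝒜 ℳ]

theorem hasHilbertExpansion_of_isHomogeneous (h_neg : ∀ γ < 0, 𝒜 γ = ⊥)
    (hn : ringKrullDim R ≤ n) (ha : HasHilbertExpansion 𝒜 (⊥ : Ideal R) n a)
    {N : Submodule R M} (hN : N.IsHomogeneous ℳ) :
    HasHilbertExpansion ℳ N n (Module.finrank R (M ⧸ N) * a) := by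
  refine homogeneous_submodule_induction 𝒜 ℳ
    (motive := fun N => HasHilbertExpansion ℳ N n (Module.finrank R (M ⧸ N) * a)) hN ?_
    fun N' δ m _ hN' hm hprime ih => ?_
  · simpa only [Module.finrank_zero_of_subsingleton, Nat.cast_zero, zero_mul] using
      HasHilbertExpansion.top ℳ n
  · rw [finrank_quotient_eq_add_finrank_quotient_colon N' m, Nat.cast_add, add_mul]
    exact .of_colon hN' hm ih (hasHilbertExpansion_of_isPrime h_neg hn ha hprime
      (isHomogeneous_colon_singleton ℳ 𝒜 hN' hm))

end Rank

theorem mainTheorem5_general {k R M : Type*} [Field k] [CommRing R] [IsDomain R]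
    [IsNoetherianRing R] [Algebra k R] (𝒜 : ℝ → Submodule k R) [GradedAlgebra 𝒜]
    [Module.Finite k (𝒜 0)] (h𝒜_neg : ∀ γ : ℝ, γ < 0 → 𝒜 γ = ⊥)
    (n : ℕ) (hn : ringKrullDim R = n)
    [AddCommGroup M] [Module k M] [Module R M] [IsScalarTower k R M] [Module.Finite R M]
    (ℳ : ℝ → Submodule k M) [DirectSum.Decomposition ℳ] [SetLike.GradedSMul 𝒜 ℳ] :
    (∀ x : ℝ, Module.Finite k (gradedLE 𝒜 x)) ∧
    (∀ x : ℝ, Module.Finite k (gradedLE ℳ x)) ∧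
    ∃ aR aM bM : ℝ,
      HasLeadingTerm (dimLE 𝒜) n aR ∧
      HasLeadingTerm (dimLE ℳ) n aM ∧
      (1 ≤ n → HasCesaroSecondTerm (dimLE ℳ) n aM bM) ∧
      aM = (Module.finrank R M : ℝ) * aR := by
  obtain ⟨aR, hR⟩ := exists_hasHilbertExpansion_of_coheight_le h𝒜_neg (p := ⊥)
    (isHomogeneous_bot 𝒜) (coheight_le_of_ringKrullDim_le hn.le ⊥)
  have hM := hasHilbertExpansion_of_isHomogeneous h𝒜_neg hn.le hR
    (isHomogeneous_bot ℳ : (⊥ : Submodule R M).IsHomogeneous ℳ)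
  rw [(Submodule.quotEquivOfEqBot (⊥ : Submodule R M) rfl).finrank_eq] at hM
  obtain ⟨bM, hbM⟩ := hM.hasCesaroExpansion_dimLE.exists_hasCesaroSecondTerm
  exact ⟨hR.finite_gradedLE, hM.finite_gradedLE, aR, _, bM,
    hR.hasCesaroExpansion_dimLE.hasLeadingTerm, hM.hasCesaroExpansion_dimLE.hasLeadingTerm, hbM,
    rfl⟩

theorem mainTheorem5 {k R M : Type*} [Field k] [IsAlgClosed k]
    [CommRing R] [IsDomain R] [Algebra k R] [Algebra.FiniteType k R]
    (𝒜 : ℝ → Submodule k R) [GradedAlgebra 𝒜]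
    (h𝒜_neg : ∀ γ : ℝ, γ < 0 → 𝒜 γ = ⊥)
    (h𝒜_zero : 𝒜 0 = (1 : Submodule k R))
    (n : ℕ) (hn : ringKrullDim R = n)
    [AddCommGroup M] [Module k M] [Module R M] [IsScalarTower k R M] [Module.Finite R M]
    (ℳ : ℝ → Submodule k M) [DirectSum.Decomposition ℳ] [SetLike.GradedSMul 𝒜 ℳ] :
    (∀ x : ℝ, Module.Finite k (gradedLE 𝒜 x)) ∧
    (∀ x : ℝ, Module.Finite k (gradedLE ℳ x)) ∧
    ∃ aR aM bM : ℝ,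
      HasLeadingTerm (dimLE 𝒜) n aR ∧
      HasLeadingTerm (dimLE ℳ) n aM ∧
      (1 ≤ n → HasCesaroSecondTerm (dimLE ℳ) n aM bM) ∧
      aM = (Module.finrank R M : ℝ) * aR := by
  have : IsNoetherianRing R := Algebra.FiniteType.isNoetherianRing k R
  have : Module.Finite k (𝒜 0) := by
    rw [h𝒜_zero, Submodule.one_eq_span]
    infer_instance
  exact mainTheorem5_general 𝒜 h𝒜_neg n hn ℳ
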